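/- Let $\mathcal X,\mathcal Y$ be finite sets, $P_X$ a probability distribution on $\mathcal X$, and $W(y\mid x,y')$ a channel from $\mathcal X\times\mathcal Y$ to $\mathcal Y$ (a probability distribution in $y$ for each $(x,y')$). Assume that the Markov chain on $\mathcal Y$ with transition matrix $T_{i,j}=\sum_{x}P_X(x)W(j\mid x,i)$ has a unique recurrent class $\mathcal R_Y$, and that this class is irreducible and aperiodic. Then the chain has a unique equilibrium distribution $\pi$, i.e. a unique probability distribution with $\pi(y)=\sum_{x,y'}\pi(y')P_X(x)W(y\mid x,y')$, and $\pi$ is supported on $\mathcal R_Y$. Put $$\mathcal Q(i,x,j)=\pi(i)\,P_X(x)\,W(j\mid x,i),\qquad (i,x,j)\in\mathcal Y\times\mathcal X\times\mathcal Y .$$ For each $n$, let $X^n=(X_1,\dots,X_n)$ and $(Y_0,\dots,Y_n)$ be random sequences such that, with an arbitrary law of the initial state $Y_0$ (which may depend on $n$), $$\mathbb P(X^n=x^n,\,Y_0=y_0,\dots,Y_n=y_n)=\mathbb P(Y_0=y_0)\prod_{t=1}^n P_X(x_t)\,W(y_t\mid x_t,y_{t-1})$$ for all $x^n\in\mathcal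 X^n$ and $(y_0,\dots,y_n)\in\mathcal Y^{n+1}$. Let $Q^n(i,x,j)=\frac1n\sum_{t=1}^n\mathbf 1\{(Y_{t-1},X_t,Y_t)=(i,x,j)\}$ be the empirical distribution of the triples. Then for every $\delta>0$, $$\lim_{n\to\infty}\mathbb P\Big(\sum_{i,x,j}\big|Q^n(i,x,j)-\mathcal Q(i,x,j)\big|\le\delta\Big)=1,$$ that is, the probability that $(X^n,Y^n)$ is input-driven Markov $\delta$-typical for $\mathcal Q$ tends to $1$. -/

import Mathlib

open MeasureTheory Filter Topology

namespace InputDrivenMarkov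

section Chain

variable {S : Type*} [Fintype S] [DecidableEq S]

/-- State `j` is accessible from state `i` (in zero or more steps) for the chain with transition
matrix `T`. -/
def Accessible (T : Matrix S S ℝ) (i j : S) : Prop :=
  ∃ n : ℕ, 0 < (T ^ n) i j

/-- Two states communicate if each of them is accessible from the other. -/
def Communicates (T : Matrix S S ℝ) (i j : S) : Prop :=
  Accessible T i j ∧ Accessible T j i

/-- `firstPassage T j n i` is the probability that the chain started in `i` visits `j` for the first
time after time `0` exactly at time `n + 1`. -/
def firstPassage (T : Matrix S S ℝ) (j : S) : ℕ → S → ℝ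
  | 0, i => T i j
  | n + 1, i => ∑ k, if k = j then 0 else T i k * firstPassage T j n k

/-- A state is recurrent if the chain started in it returns to it with probability one. -/
def IsRecurrentState (T : Matrix S S ℝ) (i : S) : Prop :=
  HasSum (fun n => firstPassage T i n i) 1

/-- A recurrent class: the communicating class of a recurrent state. -/
def IsRecurrentClass (T : Matrix S S ℝ) (R : Set S) : Prop :=
  ∃ i, IsRecurrentState T i ∧ R = {j | Communicates T i j}

/-- The chain is irreducible on `R`: any two states of `R` communicate. -/
def IsIrreducibleOn (T : Matrix S S ℝ) (R : Set S) : Prop :=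
  ∀ i ∈ R, ∀ j ∈ R, Communicates T i j

/-- A state is aperiodic if its possible return times have greatest common divisor `1`. -/
def IsAperiodicState (T : Matrix S S ℝ) (i : S) : Prop :=
  ∀ d : ℕ, (∀ n : ℕ, 1 ≤ n → 0 < (T ^ n) i i → d ∣ n) → d = 1

/-- `R` is the unique recurrent class of the chain, and it is irreducible and aperiodic. -/
structure IsUniqueErgodicClass (T : Matrix S S ℝ) (R : Set S) : Prop where
  isRecurrentClass : IsRecurrentClass T R
  unique : ∀ R' : Set S, IsRecurrentClass T R' → R' = R
  irreducible : IsIrreducibleOn T R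
  aperiodic : ∀ i ∈ R, IsAperiodicState T i

end Chain

section Channel

variable {𝒳 𝒴 : Type*} [Fintype 𝒳] [Fintype 𝒴]

/-- The transition matrix `T i j = ∑ x, P x * W (j | x, i)` of the induced chain `Y`.
The channel `W` is written `W x i j` for the probability of the output `j` given the input `x` and
the previous output `i`. -/
def inducedMatrix (P : 𝒳 → ℝ) (W : 𝒳 → 𝒴 → 𝒴 → ℝ) : Matrix 𝒴 𝒴 ℝ :=
  Matrix.of fun i j => ∑ x, P x * W x i j

/-- `π` is an equilibrium distribution of the induced chain:
`π j = ∑ x, ∑ i, π i * P x * W (j | x, i)`. -/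
structure IsEquilibrium (P : 𝒳 → ℝ) (W : 𝒳 → 𝒴 → 𝒴 → ℝ) (π : 𝒴 → ℝ) : Prop where
  mem_simplex : π ∈ stdSimplex ℝ 𝒴
  balance : ∀ j, π j = ∑ x, ∑ i, π i * P x * W x i j

/-- The target distribution `Q (i, x, j) = π i * P x * W (j | x, i)` of `(Y', X, Y)`. -/
def target (π : 𝒴 → ℝ) (P : 𝒳 → ℝ) (W : 𝒳 → 𝒴 → 𝒴 → ℝ) (i : 𝒴) (x : 𝒳) (j : 𝒴) : ℝ :=
  π i * P x * W x i j

/-- The empirical distribution of the triples `(y_{t-1}, x_t, y_t)`, `t = 1, …, n`. The sequence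
`x_1, …, x_n` is indexed by `Fin n` (so `x_{t+1}` is `x t`), and `y_0, …, y_n` by `Fin (n + 1)`. -/
noncomputable def empirical [DecidableEq 𝒳] [DecidableEq 𝒴] {n : ℕ} (xs : Fin n → 𝒳) (ys : Fin (n + 1) → 𝒴)
    (i : 𝒴) (x : 𝒳) (j : 𝒴) : ℝ :=
  (1 / (n : ℝ)) * ∑ t : Fin n, if (ys t.castSucc, xs t, ys t.succ) = (i, x, j) then 1 else 0

/-- The set of input-driven Markov typical sequences: those whose empirical distribution of triples
is within `ℓ¹`-distance `ε` of `Q`. -/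
def typicalSet [DecidableEq 𝒳] [DecidableEq 𝒴] (n : ℕ) (ε : ℝ) (Q : 𝒴 → 𝒳 → 𝒴 → ℝ) :
    Set ((Fin n → 𝒳) × (Fin (n + 1) → 𝒴)) :=
  {p | ∑ i, ∑ x, ∑ j, |empirical p.1 p.2 i x j - Q i x j| ≤ ε}

/-- The random sequences `X_1, …, X_n` and `Y_0, …, Y_n` are generated by the i.i.d. input law `P`
and the channel `W`, with an arbitrary law of the initial state `Y_0`:
`ℙ (X^n = x^n, Y_0^n = y_0^n) = ℙ (Y_0 = y_0) * ∏ t, P x_t * W (y_t | x_t, y_{t-1})`. -/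
structure IsGenerated [MeasurableSpace 𝒳] [MeasurableSpace 𝒴] {Ω : Type*} [MeasurableSpace Ω]
    (ℙ : Measure Ω) (P : 𝒳 → ℝ) (W : 𝒳 → 𝒴 → 𝒴 → ℝ) {n : ℕ}
    (X : Fin n → Ω → 𝒳) (Y : Fin (n + 1) → Ω → 𝒴) : Prop where
  measurable_input : ∀ t, Measurable (X t)
  measurable_output : ∀ t, Measurable (Y t)
  law : ∀ (xs : Fin n → 𝒳) (ys : Fin (n + 1) → 𝒴),
    ℙ.real {ω | (∀ t, X t ω = xs t) ∧ (∀ t, Y t ω = ys t)} =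
      ℙ.real {ω | Y 0 ω = ys 0} * ∏ t : Fin n, P (xs t) * W (xs t) (ys t.castSucc) (ys t.succ)

end Channel

end InputDrivenMarkov

/-! Every finite chain reaches an essential state (one accessible from all states it can reach), and
essential states are recurrent. Uniqueness of the recurrent class therefore yields a state `k`
accessible from everywhere. By the maximum principle harmonic functions are then constant, so the
Poisson equation `g - T g = f` is solvable whenever `f` has `π`-mean zero (`exists_poisson`);
uniqueness of `π` follows.

For convergence, let `F` be the centred indicator of a triple, `f` its conditional mean given the
previous output, and `g` the Poisson solution. Then `F i x j + g j - g i` is a martingale increment,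
while the correction telescopes to a bounded term. Orthogonality of increments bounds the second
moment of the sum of `F` by a multiple of `n + 1`, uniformly in the initial law
(`exists_second_moment_bound`), and Chebyshev's inequality makes the atypical probability `O(1/n)`.
-/

namespace InputDrivenMarkov

/-! ### Finite chains: accessibility and recurrence. -/

section StochasticMatrix

variable {S : Type*} [Fintype S] {T : Matrix S S ℝ}

/-- A weighted average that reaches a bound of its terms has all charged terms at the bound. -/
theorem eq_of_sum_mul_eq_of_le {w u : S → ℝ} {M : ℝ} (hw : ∀ i, 0 ≤ w i) (hw1 : ∑ i, w i = 1)
    (hu : ∀ i, 0 < w i → u i ≤ M) (h : ∑ i, w i * u i = M) {i : S} (hi : 0 < w i) : u i = M := by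
  have hle : ∀ j ∈ Finset.univ, w j * u j ≤ w j * M := fun j _ => by
    rcases (hw j).eq_or_lt with h0 | h0
    · simp [← h0]
    · exact mul_le_mul_of_nonneg_left (hu j h0) (hw j)
  have hsum : ∑ j, w j * u j = ∑ j, w j * M := by rw [h, ← Finset.sum_mul, hw1, one_mul]
  exact mul_left_cancel₀ hi.ne' ((Finset.sum_eq_sum_iff_of_le hle).1 hsum i (Finset.mem_univ i))

theorem exists_step (hT : ∀ i j, 0 ≤ T i j) (hs : ∀ i, ∑ j, T i j = 1) (i : S) :
    ∃ j, 0 < T i j := by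
  have : ∑ j, T i j ≠ 0 := by rw [hs]; exact one_ne_zero
  obtain ⟨j, -, hj⟩ := Finset.exists_ne_zero_of_sum_ne_zero this
  exact ⟨j, (hT i j).lt_of_ne' hj⟩

variable [DecidableEq S]

theorem matrix_pow_nonneg (hT : ∀ i j, 0 ≤ T i j) (n : ℕ) (i j : S) : 0 ≤ (T ^ n) i j := by
  induction n generalizing i j with
  | zero => rw [pow_zero, Matrix.one_apply]; split_ifs <;> norm_num
  | succ n ih =>
    rw [pow_succ', Matrix.mul_apply]
    exact Finset.sum_nonneg fun k _ => mul_nonneg (hT i k) (ih k j)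

theorem exists_step_of_pow_succ_pos (hT : ∀ i j, 0 ≤ T i j) {n : ℕ} {i j : S}
    (h : 0 < (T ^ (n + 1)) i j) : ∃ k, 0 < T i k ∧ 0 < (T ^ n) k j := by
  rw [pow_succ', Matrix.mul_apply] at h
  obtain ⟨k, -, hk⟩ := Finset.exists_ne_zero_of_sum_ne_zero h.ne'
  exact ⟨k, (hT i k).lt_of_ne' (left_ne_zero_of_mul hk),
    (matrix_pow_nonneg hT n k j).lt_of_ne' (right_ne_zero_of_mul hk)⟩

theorem Accessible.refl (i : S) : Accessible T i i :=
  ⟨0, by simp⟩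

theorem Accessible.trans (hT : ∀ i j, 0 ≤ T i j) {i j k : S} (hij : Accessible T i j)
    (hjk : Accessible T j k) : Accessible T i k := by
  obtain ⟨n, hn⟩ := hij
  obtain ⟨m, hm⟩ := hjk
  refine ⟨n + m, ?_⟩
  rw [pow_add, Matrix.mul_apply]
  exact (mul_pos hn hm).trans_le <| Finset.single_le_sum
    (f := fun l => (T ^ n) i l * (T ^ m) l k)
    (fun l _ => mul_nonneg (matrix_pow_nonneg hT n i l) (matrix_pow_nonneg hT m l k))
    (Finset.mem_univ j)

theorem Accessible.of_step {i j : S} (h : 0 < T i j) : Accessible T i j :=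
  ⟨1, by simpa using h⟩

theorem Accessible.mem_of_closed (hT : ∀ i j, 0 ≤ T i j) {B : Set S}
    (hB : ∀ i ∈ B, ∀ j, 0 < T i j → j ∈ B) {i k : S} (h : Accessible T i k) (hi : i ∈ B) :
    k ∈ B := by
  obtain ⟨n, hn⟩ := h
  induction n generalizing i with
  | zero =>
    rw [pow_zero, Matrix.one_apply] at hn
    split_ifs at hn with h
    · exact h ▸ hi
    · exact absurd hn (lt_irrefl 0)
  | succ n ih =>
    obtain ⟨l, hl, hl'⟩ := exists_step_of_pow_succ_pos hT hn
    exact ih (hB i hi l hl) hl'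

/-- The probability that the chain started in `i` does not visit `k` at the times `1, …, n`. -/
def avoidance (T : Matrix S S ℝ) (k : S) (n : ℕ) (i : S) : ℝ :=
  1 - ∑ m ∈ Finset.range n, firstPassage T k m i

theorem firstPassage_nonneg (hT : ∀ i j, 0 ≤ T i j) (k : S) (n : ℕ) (i : S) :
    0 ≤ firstPassage T k n i := by
  induction n generalizing i with
  | zero => exact hT i k
  | succ n ih =>
    refine Finset.sum_nonneg fun l _ => ?_
    split_ifs
    · exact le_rfl
    · exact mul_nonneg (hT i l) (ih l)

theorem avoidance_succ (hs : ∀ i, ∑ j, T i j = 1) (k : S) (n : ℕ) (i : S) :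
    avoidance T k (n + 1) i = ∑ l, T i l * (if l = k then 0 else avoidance T k n l) := by
  have h1 : ∀ l, T i l * (if l = k then 0 else avoidance T k n l) =
      T i l - (if l = k then T i l else 0) -
        ∑ m ∈ Finset.range n, (if l = k then 0 else T i l * firstPassage T k m l) := by
    intro l
    split_ifs
    · simp
    · rw [avoidance, mul_sub, Finset.mul_sum]; ring
  rw [Finset.sum_congr rfl fun l _ => h1 l, Finset.sum_sub_distrib, Finset.sum_sub_distrib, hs,
    Finset.sum_comm, avoidance, Finset.sum_range_succ']
  simp only [firstPassage, Finset.sum_ite_eq', Finset.mem_univ, if_true]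
  ring

theorem avoidance_nonneg (hT : ∀ i j, 0 ≤ T i j) (hs : ∀ i, ∑ j, T i j = 1) (k : S) (n : ℕ)
    (i : S) : 0 ≤ avoidance T k n i := by
  induction n generalizing i with
  | zero => simp [avoidance]
  | succ n ih =>
    rw [avoidance_succ hs]
    refine Finset.sum_nonneg fun l _ => mul_nonneg (hT i l) ?_
    split_ifs
    · exact le_rfl
    · exact ih l

theorem summable_firstPassage (hT : ∀ i j, 0 ≤ T i j) (hs : ∀ i, ∑ j, T i j = 1) (k i : S) :
    Summable fun n => firstPassage T k n i :=
  summable_of_sum_range_le (c := 1) (fun n => firstPassage_nonneg hT k n i)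
    fun n => sub_nonneg.1 (avoidance_nonneg hT hs k n i)

/-- A state to which the chain can return from every state that it can reach is recurrent. -/
theorem isRecurrentState_of_essential (hT : ∀ i j, 0 ≤ T i j) (hs : ∀ i, ∑ j, T i j = 1) {k : S}
    (hk : ∀ j, Accessible T k j → Accessible T j k) : IsRecurrentState T k := by
  -- `u i` is the probability of never visiting `k` after time 0. First-step analysis makes it
  -- harmonic once the value at `k` inside the average is replaced by 0.
  set u : S → ℝ := fun i => 1 - ∑' n, firstPassage T k n i with hu
  have hlim : ∀ i, Tendsto (fun n => avoidance T k n i) atTop (𝓝 (u i)) := fun i =>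
    tendsto_const_nhds.sub (summable_firstPassage hT hs k i).hasSum.tendsto_sum_nat
  have hu0 : ∀ i, 0 ≤ u i := fun i =>
    ge_of_tendsto' (hlim i) fun n => avoidance_nonneg hT hs k n i
  have hharm : ∀ i, u i = ∑ l, T i l * (if l = k then 0 else u l) := by
    intro i
    refine tendsto_nhds_unique ((tendsto_add_atTop_iff_nat 1).2 (hlim i)) ?_
    simp only [avoidance_succ hs]
    refine tendsto_finsetSum _ fun l _ => Tendsto.const_mul _ ?_
    split_ifs
    · exact tendsto_const_nhds
    · exact hlim l
  classical
  obtain ⟨i, hi, hmax⟩ := Finset.exists_max_image (Finset.univ.filter fun j => Accessible T k j) u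
    ⟨k, by simp [Accessible.refl]⟩
  simp only [Finset.mem_filter, Finset.mem_univ, true_and] at hi hmax
  -- If the maximum over the states accessible from `k` were positive, every step from a maximiser
  -- would avoid `k` and lead to another maximiser, so `k` could never be reached again.
  have hzero : u i = 0 := by
    by_contra hne
    have hpos : 0 < u i := (hu0 i).lt_of_ne' hne
    have key : ∀ j, Accessible T k j → u j = u i → ∀ l, 0 < T j l → l ≠ k ∧ u l = u i := by
      intro j hj hji l hl
      have := eq_of_sum_mul_eq_of_le (u := fun l => if l = k then 0 else u l) (hT j) (hs j)
        (fun m hm => by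
          split_ifs
          · exact hu0 i
          · exact hmax m (hj.trans hT (.of_step hm))) ((hharm j).symm.trans hji) hl
      split_ifs at this with h
      · exact absurd this.symm hne
      · exact ⟨h, this⟩
    obtain ⟨l, hl⟩ := exists_step hT hs i
    obtain ⟨hlk, hli⟩ := key i hi rfl l hl
    have hkl : Accessible T k l := hi.trans hT (.of_step hl)
    have := (hk l hkl).mem_of_closed hT (B := {j | Accessible T k j ∧ u j = u i ∧ j ≠ k})
      (fun j hj m hm => ⟨hj.1.trans hT (.of_step hm), (key j hj.1 hj.2.1 m hm).2,
        (key j hj.1 hj.2.1 m hm).1⟩) ⟨hkl, hli, hlk⟩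
    exact this.2.2 rfl
  have huk : u k = 0 := le_antisymm (hzero ▸ hmax k (Accessible.refl k)) (hu0 k)
  have h1 : ∑' n, firstPassage T k n k = 1 := (sub_eq_zero.1 huk).symm
  rw [IsRecurrentState, ← h1]
  exact (summable_firstPassage hT hs k k).hasSum

/-- From every state of a finite chain an essential state can be reached. -/
theorem exists_accessible_essential (hT : ∀ i j, 0 ≤ T i j) (i : S) :
    ∃ k, Accessible T i k ∧ ∀ j, Accessible T k j → Accessible T j k := by
  classical
  let A : S → Finset S := fun k => Finset.univ.filter fun j => Accessible T k j
  -- Minimality of the accessible set forces `A j = A k` for every `j` accessible from `k`, hence `k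
  -- ∈ A j`.
  obtain ⟨k, hk, hmin⟩ := Finset.exists_min_image (A i) (fun k => (A k).card)
    ⟨i, by simp [A, Accessible.refl]⟩
  simp only [A, Finset.mem_filter, Finset.mem_univ, true_and] at hk hmin
  refine ⟨k, hk, fun j hj => ?_⟩
  have hsub : A j ⊆ A k := fun l hl => by
    simp only [A, Finset.mem_filter, Finset.mem_univ, true_and] at hl ⊢
    exact hj.trans hT hl
  have hkj : k ∈ A j := by
    rw [Finset.eq_of_subset_of_card_le hsub (hmin j (hk.trans hT hj))]
    simp [A, Accessible.refl]
  simpa [A] using hkj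

/-- The unique recurrent class is closed, and one of its states can be reached from everywhere. -/
theorem IsUniqueErgodicClass.closed_and_reachable (hT : ∀ i j, 0 ≤ T i j)
    (hs : ∀ i, ∑ j, T i j = 1) {R : Set S} (hR : IsUniqueErgodicClass T R) :
    (∀ i ∈ R, ∀ j, 0 < T i j → j ∈ R) ∧ ∃ k ∈ R, ∀ i, Accessible T i k := by
  have hclass : ∀ k, (∀ j, Accessible T k j → Accessible T j k) → {j | Communicates T k j} = R :=
    fun k hk => hR.unique _ ⟨k, isRecurrentState_of_essential hT hs hk, rfl⟩
  obtain ⟨r, -, hr⟩ := hR.isRecurrentClass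
  -- The class of any essential state is `R`. Thus `R` is closed, and `k` lies in the class of an
  -- essential state reached from an arbitrary `i`.
  obtain ⟨k, -, hk⟩ := exists_accessible_essential hT r
  have hkR := hclass k hk
  refine ⟨?_, k, hkR ▸ ⟨Accessible.refl k, Accessible.refl k⟩, fun i => ?_⟩
  · rw [← hkR]
    intro i hi j hj
    have := hi.1.trans hT (.of_step hj)
    exact ⟨this, hk j this⟩
  · obtain ⟨l, hl, hl'⟩ := exists_accessible_essential hT i
    have hkl : k ∈ {j | Communicates T l j} := by
      rw [hclass l hl', ← hkR]
      exact ⟨Accessible.refl k, Accessible.refl k⟩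
    exact hl.trans hT hkl.1

/-! ### Harmonic functions, stationary distributions and the Poisson equation. -/

/-- Maximum principle: the set where `h` is maximal is closed under steps, so it contains `k`; the
same applies to `-h`. -/
theorem harmonic_eq_of_reachable (hT : ∀ i j, 0 ≤ T i j) (hs : ∀ i, ∑ j, T i j = 1) {k : S}
    (hk : ∀ i, Accessible T i k) {h : S → ℝ} (hh : ∀ i, ∑ j, T i j * h j = h i) (i : S) :
    h i = h k := by
  have le : ∀ {h : S → ℝ}, (∀ i, ∑ j, T i j * h j = h i) → ∀ i, h i ≤ h k := by
    intro h hh i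
    obtain ⟨m, -, hm⟩ := Finset.exists_max_image Finset.univ h ⟨k, Finset.mem_univ k⟩
    have : h k = h m := (hk m).mem_of_closed hT (B := {j | h j = h m})
      (fun j hj l hl => eq_of_sum_mul_eq_of_le (hT j) (hs j)
        (fun q _ => hm q (Finset.mem_univ q)) ((hh j).trans hj) hl) rfl
    exact this ▸ hm i (Finset.mem_univ i)
  refine le_antisymm (le hh i) (neg_le_neg_iff.1 (le (h := fun i => -h i) (fun i => ?_) i))
  simp [← hh i]

/-- Constants lie in the kernel of `1 - T`, so there is a nonzero left null vector `v`. Then `|v| ≤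
|v| T` entrywise with equal total masses, which forces equality; normalise `|v|`. -/
theorem exists_stationary [Nonempty S] (hT : ∀ i j, 0 ≤ T i j) (hs : ∀ i, ∑ j, T i j = 1) :
    ∃ π ∈ stdSimplex ℝ S, ∀ j, ∑ i, π i * T i j = π j := by
  have h1 : ∃ v : S → ℝ, v ≠ 0 ∧ (1 - T).mulVec v = 0 := by
    refine ⟨fun _ => 1, fun h => one_ne_zero (congrFun h (Classical.arbitrary S)), ?_⟩
    ext i
    rw [Matrix.sub_mulVec, Matrix.one_mulVec]
    simp [Matrix.mulVec, dotProduct, hs]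
  obtain ⟨v, hv0, hv⟩ := Matrix.exists_vecMul_eq_zero_iff.2 (Matrix.exists_mulVec_eq_zero_iff.1 h1)
  have hvT : ∀ j, ∑ i, v i * T i j = v j := by
    intro j
    have := congrFun hv j
    rw [Matrix.vecMul_sub, Matrix.vecMul_one, Pi.sub_apply, Pi.zero_apply, sub_eq_zero] at this
    exact this.symm
  have hle : ∀ j ∈ Finset.univ, |v j| ≤ ∑ i, |v i| * T i j := by
    intro j _
    conv_lhs => rw [← hvT j]
    refine (Finset.abs_sum_le_sum_abs _ _).trans_eq (Finset.sum_congr rfl fun i _ => ?_)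
    rw [abs_mul, abs_of_nonneg (hT i j)]
  have hsum : ∑ j, |v j| = ∑ j, ∑ i, |v i| * T i j := by
    rw [Finset.sum_comm]
    simp [← Finset.mul_sum, hs]
  have heq := (Finset.sum_eq_sum_iff_of_le hle).1 hsum
  obtain ⟨i, hi⟩ := Function.ne_iff.1 hv0
  have hpos : 0 < ∑ j, |v j| :=
    (abs_pos.2 hi).trans_le (Finset.single_le_sum (f := fun j => |v j|)
      (fun j _ => abs_nonneg _) (Finset.mem_univ i))
  refine ⟨fun i => |v i| / ∑ j, |v j|, ⟨fun i => by positivity, ?_⟩, fun j => ?_⟩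
  · rw [← Finset.sum_div, div_self hpos.ne']
  · change ∑ i, |v i| / (∑ l, |v l|) * T i j = |v j| / ∑ l, |v l|
    rw [heq j (Finset.mem_univ j), Finset.sum_div]
    exact Finset.sum_congr rfl fun i _ => by ring

/-- Solvability of the Poisson equation. -/
theorem exists_poisson (hT : ∀ i j, 0 ≤ T i j) (hs : ∀ i, ∑ j, T i j = 1) {k : S}
    (hk : ∀ i, Accessible T i k) {π : S → ℝ} (hπ : ∑ i, π i = 1)
    (hst : ∀ j, ∑ i, π i * T i j = π j) {f : S → ℝ} (hf : ∑ i, π i * f i = 0) :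
    ∃ g : S → ℝ, ∀ i, g i - ∑ j, T i j * g j = f i := by
  have hπT : ∀ g : S → ℝ, ∑ i, π i * ∑ j, T i j * g j = ∑ j, π j * g j := by
    intro g
    simp_rw [Finset.mul_sum]
    rw [Finset.sum_comm]
    refine Finset.sum_congr rfl fun j _ => ?_
    rw [← hst j, Finset.sum_mul]
    exact Finset.sum_congr rfl fun i _ => by ring
  -- `1 - T` kills constants; adding the rank-one term `π g` makes it injective, hence surjective.
  -- Since `π (Φ g) = π g`, the added term vanishes when `f` has mean zero.
  let Φ : (S → ℝ) →ₗ[ℝ] (S → ℝ) :=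
    { toFun := fun g i => g i - ∑ j, T i j * g j + ∑ j, π j * g j
      map_add' := fun g h => by
        ext i
        simp only [Pi.add_apply, mul_add, Finset.sum_add_distrib]
        ring
      map_smul' := fun c g => by
        ext i
        simp only [Pi.smul_apply, smul_eq_mul, RingHom.id_apply, mul_add, mul_sub,
          Finset.mul_sum, mul_left_comm c] }
  have hΦ : ∀ g i, Φ g i = g i - ∑ j, T i j * g j + ∑ j, π j * g j := fun _ _ => rfl
  have hπΦ : ∀ g, ∑ i, π i * Φ g i = ∑ j, π j * g j := by
    intro g
    simp only [hΦ, mul_add, mul_sub, Finset.sum_add_distrib, Finset.sum_sub_distrib, hπT]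
    rw [← Finset.sum_mul, hπ]
    ring
  have hinj : Function.Injective Φ := by
    refine (injective_iff_map_eq_zero Φ).2 fun g hg => ?_
    have h0 : ∑ j, π j * g j = 0 := by rw [← hπΦ g, hg]; simp
    have hconst := harmonic_eq_of_reachable hT hs hk (h := g) fun i => by
      have := congrFun hg i
      rw [hΦ, h0, add_zero, Pi.zero_apply, sub_eq_zero] at this
      exact this.symm
    have hgk : g k = 0 := by
      rw [← h0, Finset.sum_congr rfl fun j _ => by rw [hconst j], ← Finset.sum_mul, hπ, one_mul]
    ext i
    rw [hconst i, hgk, Pi.zero_apply]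
  obtain ⟨g, hg⟩ := LinearMap.surjective_of_injective hinj f
  have h0 : ∑ j, π j * g j = 0 := by rw [← hπΦ g, hg, hf]
  refine ⟨g, fun i => ?_⟩
  rw [← hg, hΦ, h0, add_zero]

/-- Any stationary `π'` annihilates `g - T g`; choosing this to be the indicator of `a` minus `π a`
gives `π' a = π a`. -/
theorem stationary_unique (hT : ∀ i j, 0 ≤ T i j) (hs : ∀ i, ∑ j, T i j = 1) {k : S}
    (hk : ∀ i, Accessible T i k) {π π' : S → ℝ} (hπ : ∑ i, π i = 1)
    (hst : ∀ j, ∑ i, π i * T i j = π j) (hπ' : ∑ i, π' i = 1)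
    (hst' : ∀ j, ∑ i, π' i * T i j = π' j) : π' = π := by
  ext a
  obtain ⟨g, hg⟩ := exists_poisson hT hs hk hπ hst
    (f := fun i => (if i = a then 1 else 0) - π a) (by
      simp [mul_sub, Finset.sum_sub_distrib, ← Finset.sum_mul, hπ])
  have h0 : ∑ i, π' i * (g i - ∑ j, T i j * g j) = 0 := by
    simp_rw [mul_sub, Finset.sum_sub_distrib, Finset.mul_sum]
    rw [Finset.sum_comm (f := fun i j => π' i * (T i j * g j)), sub_eq_zero]
    refine Finset.sum_congr rfl fun j _ => ?_
    conv_lhs => rw [← hst' j, Finset.sum_mul]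
    exact Finset.sum_congr rfl fun i _ => by ring
  simp_rw [hg] at h0
  simpa [mul_sub, Finset.sum_sub_distrib, ← Finset.sum_mul, hπ', sub_eq_zero] using h0

/-- A stationary distribution does not charge states outside a closed set that can be reached from
everywhere. -/
theorem stationary_eq_zero_of_notMem (hT : ∀ i j, 0 ≤ T i j) (hs : ∀ i, ∑ j, T i j = 1)
    {R : Set S} (hR : ∀ i ∈ R, ∀ j, 0 < T i j → j ∈ R) {k : S} (hkR : k ∈ R)
    (hk : ∀ i, Accessible T i k) {π : S → ℝ} (hπ : ∀ i, 0 ≤ π i)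
    (hst : ∀ j, ∑ i, π i * T i j = π j) {i : S} (hi : i ∉ R) : π i = 0 := by
  classical
  by_contra hne
  -- `q` is the probability of being in `R` after one step. It dominates the indicator of `R` and
  -- has the same `π`-mean, so charged states outside `R` cannot step into `R`, although `k ∈ R` is
  -- accessible from them.
  let q : S → ℝ := fun i => ∑ j, T i j * (if j ∈ R then 1 else 0)
  have hq : ∀ i, (if i ∈ R then 1 else 0) ≤ q i := by
    intro i
    split_ifs with h
    · rw [← hs i]
      refine Finset.sum_le_sum fun j _ => ?_
      rcases (hT i j).eq_or_lt with h0 | h0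
      · simp [← h0]
      · simp [hR i h j h0]
    · exact Finset.sum_nonneg fun j _ => mul_nonneg (hT i j) (by split_ifs <;> norm_num)
  have hsum : ∑ i, π i * (if i ∈ R then 1 else 0) = ∑ i, π i * q i := by
    simp_rw [q, Finset.mul_sum]
    rw [Finset.sum_comm]
    refine Finset.sum_congr rfl fun j _ => ?_
    conv_lhs => rw [← hst j, Finset.sum_mul]
    exact Finset.sum_congr rfl fun i _ => by ring
  have heq := (Finset.sum_eq_sum_iff_of_le
    fun i _ => mul_le_mul_of_nonneg_left (hq i) (hπ i)).1 hsum
  have := (hk i).mem_of_closed hT (B := {j | j ∉ R ∧ 0 < π j}) (fun j hj l hl => ?_)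
    ⟨hi, (hπ i).lt_of_ne' hne⟩
  · exact this.1 hkR
  · refine ⟨fun hlR => ?_, ?_⟩
    · have h1 := mul_left_cancel₀ hj.2.ne' (heq j (Finset.mem_univ j))
      rw [if_neg hj.1] at h1
      have h2 : T j l * (if l ∈ R then 1 else 0) ≤ q j :=
        Finset.single_le_sum (f := fun l => T j l * (if l ∈ R then (1 : ℝ) else 0))
          (fun l _ => mul_nonneg (hT j l) (by split_ifs <;> norm_num)) (Finset.mem_univ l)
      rw [if_pos hlR, mul_one, ← h1] at h2
      exact hl.not_ge h2
    · rw [← hst l]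
      exact (mul_pos hj.2 hl).trans_le (Finset.single_le_sum (f := fun m => π m * T m l)
        (fun m _ => mul_nonneg (hπ m) (hT m l)) (Finset.mem_univ j))

end StochasticMatrix

end InputDrivenMarkov

namespace InputDrivenMarkov

/-! ### Path sums and the martingale second-moment bound. -/

section Paths

variable {𝒳 𝒴 : Type*} {P : 𝒳 → ℝ} {W : 𝒳 → 𝒴 → 𝒴 → ℝ}

/-- The probability of the inputs `xs` and the outputs `ys` given the initial state. -/
def pathWeight (P : 𝒳 → ℝ) (W : 𝒳 → 𝒴 → 𝒴 → ℝ) {n : ℕ} (xs : Fin n → 𝒳)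
    (ys : Fin (n + 1) → 𝒴) : ℝ :=
  ∏ t : Fin n, P (xs t) * W (xs t) (ys t.castSucc) (ys t.succ)

theorem pathWeight_nonneg (hP : ∀ x, 0 ≤ P x) (hW : ∀ x i j, 0 ≤ W x i j) {n : ℕ}
    (xs : Fin n → 𝒳) (ys : Fin (n + 1) → 𝒴) : 0 ≤ pathWeight P W xs ys :=
  Finset.prod_nonneg fun _ _ => mul_nonneg (hP _) (hW _ _ _)

theorem pathWeight_cons {n : ℕ} (x : 𝒳) (xs : Fin n → 𝒳) (i : 𝒴) (ys : Fin (n + 1) → 𝒴) :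
    pathWeight P W (Fin.cons x xs : Fin (n + 1) → 𝒳) (Fin.cons i ys : Fin (n + 2) → 𝒴) =
      P x * W x i (ys 0) * pathWeight P W xs ys := by
  simp [pathWeight, Fin.prod_univ_succ]

/-- The sum of a function of the triples `(y_{t-1}, x_t, y_t)` along a path. -/
def pathSum (D : 𝒴 → 𝒳 → 𝒴 → ℝ) {n : ℕ} (xs : Fin n → 𝒳) (ys : Fin (n + 1) → 𝒴) : ℝ :=
  ∑ t : Fin n, D (ys t.castSucc) (xs t) (ys t.succ)

theorem pathSum_cons (D : 𝒴 → 𝒳 → 𝒴 → ℝ) {n : ℕ} (x : 𝒳) (xs : Fin n → 𝒳) (i : 𝒴)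
    (ys : Fin (n + 1) → 𝒴) :
    pathSum D (Fin.cons x xs : Fin (n + 1) → 𝒳) (Fin.cons i ys : Fin (n + 2) → 𝒴) =
      D i x (ys 0) + pathSum D xs ys := by
  simp [pathSum, Fin.sum_univ_succ]

theorem pathSum_coboundary (g : 𝒴 → ℝ) {n : ℕ} (xs : Fin n → 𝒳) (ys : Fin (n + 1) → 𝒴) :
    pathSum (fun i _ j => g j - g i) xs ys = g (ys (Fin.last n)) - g (ys 0) := by
  have h := (Fin.sum_univ_succ fun t => g (ys t)).symm.trans
    (Fin.sum_univ_castSucc fun t => g (ys t))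
  rw [pathSum, Finset.sum_sub_distrib]
  linarith

theorem sum_fin_cons {α : Type*} [Fintype α] {n : ℕ} (f : (Fin (n + 1) → α) → ℝ) :
    ∑ v, f v = ∑ a, ∑ v : Fin n → α, f (Fin.cons a v) := by
  rw [← (Fin.consEquiv fun _ => α).sum_comp, Fintype.sum_prod_type]
  rfl

variable [Fintype 𝒳] [Fintype 𝒴]

/-- The increments of a martingale are orthogonal: second moment of a path sum with conditionally
centred terms, started from the value `c`. -/
theorem sum_pathWeight_mul_sq_le (hP : ∀ x, 0 ≤ P x) (hW : ∀ x i j, 0 ≤ W x i j)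
    (hPW : ∀ i, ∑ x, ∑ j, P x * W x i j = 1) {D : 𝒴 → 𝒳 → 𝒴 → ℝ}
    (hD : ∀ i, ∑ x, ∑ j, P x * W x i j * D i x j = 0) {C : ℝ}
    (hC : ∀ i, ∑ x, ∑ j, P x * W x i j * D i x j ^ 2 ≤ C) (n : ℕ) (i : 𝒴) (c : ℝ) :
    ∑ xs : Fin n → 𝒳, ∑ ys : Fin n → 𝒴,
      pathWeight P W xs (Fin.cons i ys : Fin (n + 1) → 𝒴) *
        (c + pathSum D xs (Fin.cons i ys : Fin (n + 1) → 𝒴)) ^ 2 ≤ c ^ 2 + n * C := by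
  induction n generalizing i c with
  | zero => simp [pathWeight, pathSum]
  | succ n ih =>
    -- Splitting off the first step moves the starting value to `c + D i x j`, hence the induction
    -- over all `c`. The cross term then vanishes by `hD`.
    have hstep : ∑ xs : Fin (n + 1) → 𝒳, ∑ ys : Fin (n + 1) → 𝒴,
        pathWeight P W xs (Fin.cons i ys : Fin (n + 2) → 𝒴) *
          (c + pathSum D xs (Fin.cons i ys : Fin (n + 2) → 𝒴)) ^ 2 =
        ∑ x, ∑ j, P x * W x i j * ∑ xs : Fin n → 𝒳, ∑ ys : Fin n → 𝒴,
          pathWeight P W xs (Fin.cons j ys : Fin (n + 1) → 𝒴) *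
            (c + D i x j + pathSum D xs (Fin.cons j ys : Fin (n + 1) → 𝒴)) ^ 2 := by
      rw [sum_fin_cons]
      refine Finset.sum_congr rfl fun x _ => ?_
      simp_rw [sum_fin_cons (α := 𝒴), pathWeight_cons, pathSum_cons, Fin.cons_zero,
        Finset.mul_sum]
      rw [Finset.sum_comm]
      refine Finset.sum_congr rfl fun j _ => Finset.sum_congr rfl fun xs _ =>
        Finset.sum_congr rfl fun ys _ => ?_
      ring
    rw [hstep]
    calc _ ≤ ∑ x, ∑ j, P x * W x i j * ((c + D i x j) ^ 2 + n * C) :=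
          Finset.sum_le_sum fun x _ => Finset.sum_le_sum fun j _ =>
            mul_le_mul_of_nonneg_left (ih j _) (mul_nonneg (hP x) (hW x i j))
      _ = (∑ x, ∑ j, P x * W x i j) * (c ^ 2 + n * C) +
            2 * c * (∑ x, ∑ j, P x * W x i j * D i x j) +
              ∑ x, ∑ j, P x * W x i j * D i x j ^ 2 := by
          simp only [Finset.sum_mul, Finset.mul_sum, ← Finset.sum_add_distrib]
          refine Finset.sum_congr rfl fun x _ => Finset.sum_congr rfl fun j _ => ?_
          ring
      _ ≤ c ^ 2 + (n + 1 : ℕ) * C := by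
          rw [hPW, hD]
          push_cast
          linarith [hC i]

theorem sum_initial_mul_pathWeight_mul_sq_le (hP : ∀ x, 0 ≤ P x) (hW : ∀ x i j, 0 ≤ W x i j)
    (hPW : ∀ i, ∑ x, ∑ j, P x * W x i j = 1) {D : 𝒴 → 𝒳 → 𝒴 → ℝ}
    (hD : ∀ i, ∑ x, ∑ j, P x * W x i j * D i x j = 0) {C : ℝ}
    (hC : ∀ i, ∑ x, ∑ j, P x * W x i j * D i x j ^ 2 ≤ C) (n : ℕ) {ν : 𝒴 → ℝ}
    (hν : ν ∈ stdSimplex ℝ 𝒴) (c : ℝ) :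
    ∑ xs : Fin n → 𝒳, ∑ ys : Fin (n + 1) → 𝒴,
      ν (ys 0) * pathWeight P W xs ys * (c + pathSum D xs ys) ^ 2 ≤ c ^ 2 + n * C := by
  calc _ = ∑ i, ν i * ∑ xs : Fin n → 𝒳, ∑ ys : Fin n → 𝒴,
        pathWeight P W xs (Fin.cons i ys : Fin (n + 1) → 𝒴) *
          (c + pathSum D xs (Fin.cons i ys : Fin (n + 1) → 𝒴)) ^ 2 := by
        simp_rw [sum_fin_cons (α := 𝒴), Fin.cons_zero, Finset.mul_sum]
        rw [Finset.sum_comm]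
        simp only [mul_assoc]
    _ ≤ ∑ i, ν i * (c ^ 2 + n * C) := Finset.sum_le_sum fun i _ =>
        mul_le_mul_of_nonneg_left (sum_pathWeight_mul_sq_le hP hW hPW hD hC n i c) (hν.1 i)
    _ = c ^ 2 + n * C := by rw [← Finset.sum_mul, hν.2, one_mul]

/-- The second moment of the sum along a path of a function of the triples which is centred in
equilibrium grows at most linearly, uniformly in the initial law. -/
theorem exists_second_moment_bound [DecidableEq 𝒴] (hP : ∀ x, 0 ≤ P x)
    (hW : ∀ x i j, 0 ≤ W x i j) (hPW : ∀ i, ∑ x, ∑ j, P x * W x i j = 1) {k : 𝒴}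
    (hk : ∀ i, Accessible (inducedMatrix P W) i k) {π : 𝒴 → ℝ} (hπ : ∑ i, π i = 1)
    (hst : ∀ j, ∑ i, π i * inducedMatrix P W i j = π j) {F : 𝒴 → 𝒳 → 𝒴 → ℝ}
    (hF : ∑ i, π i * ∑ x, ∑ j, P x * W x i j * F i x j = 0) :
    ∃ K : ℝ, ∀ (n : ℕ) (ν : 𝒴 → ℝ), ν ∈ stdSimplex ℝ 𝒴 →
      ∑ xs : Fin n → 𝒳, ∑ ys : Fin (n + 1) → 𝒴,
        ν (ys 0) * pathWeight P W xs ys * pathSum F xs ys ^ 2 ≤ K * (n + 1) := by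
  have hT : ∀ i j, 0 ≤ inducedMatrix P W i j := fun i j =>
    Finset.sum_nonneg fun x _ => mul_nonneg (hP x) (hW x i j)
  have hs : ∀ i, ∑ j, inducedMatrix P W i j = 1 := fun i => by
    rw [← hPW i, Finset.sum_comm]
    rfl
  obtain ⟨g, hg⟩ := exists_poisson hT hs hk hπ hst hF
  -- The Poisson equation says exactly that this correction of `F` is conditionally centred.
  set D : 𝒴 → 𝒳 → 𝒴 → ℝ := fun i x j => F i x j + (g j - g i) with hDdef
  have hD : ∀ i, ∑ x, ∑ j, P x * W x i j * D i x j = 0 := by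
    intro i
    have h1 : ∑ x, ∑ j, P x * W x i j * g j = ∑ j, inducedMatrix P W i j * g j := by
      rw [Finset.sum_comm]
      simp [inducedMatrix, Finset.sum_mul]
    have h2 : ∑ x, ∑ j, P x * W x i j * g i = g i := by
      simp_rw [← Finset.sum_mul]
      rw [hPW, one_mul]
    simp only [hDdef, mul_add, mul_sub, Finset.sum_add_distrib, Finset.sum_sub_distrib]
    rw [h1, h2, ← hg i]
    ring
  set C : ℝ := ∑ i, ∑ x, ∑ j, P x * W x i j * D i x j ^ 2
  have hterm : ∀ i, 0 ≤ ∑ x, ∑ j, P x * W x i j * D i x j ^ 2 := fun i =>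
    Finset.sum_nonneg fun x _ => Finset.sum_nonneg fun j _ =>
      mul_nonneg (mul_nonneg (hP x) (hW x i j)) (sq_nonneg _)
  have hC : ∀ i, ∑ x, ∑ j, P x * W x i j * D i x j ^ 2 ≤ C := fun i =>
    Finset.single_le_sum (f := fun i => ∑ x, ∑ j, P x * W x i j * D i x j ^ 2)
      (fun i _ => hterm i) (Finset.mem_univ i)
  have hC0 : 0 ≤ C := Finset.sum_nonneg fun i _ => hterm i
  set G : ℝ := ∑ i, |g i|
  have hG : ∀ i, |g i| ≤ G := fun i =>
    Finset.single_le_sum (f := fun i => |g i|) (fun i _ => abs_nonneg _) (Finset.mem_univ i)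
  have hG0 : 0 ≤ G := Finset.sum_nonneg fun i _ => abs_nonneg _
  -- With `d` the sum of `D` and boundary term `|b| ≤ 2G`, `(d - b)² ≤ 2d² + 8G²`. Writing the right
  -- side as two squares lets the moment bound apply with `c = 2G` and `c = -2G`.
  have hbound : ∀ {n : ℕ} (xs : Fin n → 𝒳) (ys : Fin (n + 1) → 𝒴),
      pathSum F xs ys ^ 2 ≤ (2 * G + pathSum D xs ys) ^ 2 + (2 * G - pathSum D xs ys) ^ 2 := by
    intro n xs ys
    have h1 : pathSum D xs ys = pathSum F xs ys + (g (ys (Fin.last n)) - g (ys 0)) := by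
      rw [← pathSum_coboundary g xs ys]
      exact Finset.sum_add_distrib
    have h2 : |g (ys (Fin.last n)) - g (ys 0)| ≤ |2 * G| := by
      rw [abs_of_nonneg (by positivity : 0 ≤ 2 * G)]
      linarith [abs_sub (g (ys (Fin.last n))) (g (ys 0)), hG (ys (Fin.last n)), hG (ys 0)]
    have h3 := sq_le_sq.2 h2
    have h4 : pathSum F xs ys = pathSum D xs ys - (g (ys (Fin.last n)) - g (ys 0)) := by linarith
    rw [h4]
    nlinarith [sq_nonneg (pathSum D xs ys + (g (ys (Fin.last n)) - g (ys 0)))]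
  refine ⟨8 * G ^ 2 + 2 * C, fun n ν hν => ?_⟩
  have hm := sum_initial_mul_pathWeight_mul_sq_le hP hW hPW hD hC n hν
  have hsq : ∀ {n : ℕ} (xs : Fin n → 𝒳) (ys : Fin (n + 1) → 𝒴),
      (2 * G - pathSum D xs ys) ^ 2 = (-(2 * G) + pathSum D xs ys) ^ 2 := fun xs ys => by ring
  calc _ ≤ ∑ xs : Fin n → 𝒳, ∑ ys : Fin (n + 1) → 𝒴, ν (ys 0) * pathWeight P W xs ys *
          ((2 * G + pathSum D xs ys) ^ 2 + (2 * G - pathSum D xs ys) ^ 2) :=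
        Finset.sum_le_sum fun xs _ => Finset.sum_le_sum fun ys _ =>
          mul_le_mul_of_nonneg_left (hbound xs ys)
            (mul_nonneg (hν.1 _) (pathWeight_nonneg hP hW xs ys))
    _ ≤ ((2 * G) ^ 2 + n * C) + ((-(2 * G)) ^ 2 + n * C) := by
        simp only [hsq, mul_add, Finset.sum_add_distrib]
        exact add_le_add (hm _) (hm _)
    _ ≤ (8 * G ^ 2 + 2 * C) * (n + 1) := by
        have : (0 : ℝ) ≤ n * G ^ 2 := by positivity
        nlinarith

end Paths

end InputDrivenMarkov

namespace InputDrivenMarkov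

/-! ### From second moments to typicality. -/

section Typicality

variable {𝒳 𝒴 : Type*} {P : 𝒳 → ℝ} {W : 𝒳 → 𝒴 → 𝒴 → ℝ}

/-- The indicator of a triple, centred by its target probability. -/
def centredIndicator [DecidableEq 𝒳] [DecidableEq 𝒴] (π : 𝒴 → ℝ) (P : 𝒳 → ℝ) (W : 𝒳 → 𝒴 → 𝒴 → ℝ) (a : 𝒴 × 𝒳 × 𝒴) (i : 𝒴)
    (x : 𝒳) (j : 𝒴) : ℝ :=
  (if (i, x, j) = a then 1 else 0) - target π P W a.1 a.2.1 a.2.2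

theorem empirical_sub_target [DecidableEq 𝒳] [DecidableEq 𝒴] {π : 𝒴 → ℝ} {n : ℕ} (hn : n ≠ 0) (xs : Fin n → 𝒳)
    (ys : Fin (n + 1) → 𝒴) (a : 𝒴 × 𝒳 × 𝒴) :
    empirical xs ys a.1 a.2.1 a.2.2 - target π P W a.1 a.2.1 a.2.2 =
      pathSum (centredIndicator π P W a) xs ys / n := by
  have hn' : (n : ℝ) ≠ 0 := Nat.cast_ne_zero.2 hn
  simp only [empirical, pathSum, centredIndicator, Finset.sum_sub_distrib, Finset.sum_const,
    Finset.card_univ, Fintype.card_fin, nsmul_eq_mul]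
  field_simp

variable [Fintype 𝒳] [Fintype 𝒴]

theorem sum_weight_mul_eq_one (hP : P ∈ stdSimplex ℝ 𝒳) (hW : ∀ x i, W x i ∈ stdSimplex ℝ 𝒴)
    (i : 𝒴) : ∑ x, ∑ j, P x * W x i j = 1 := by
  simp_rw [← Finset.mul_sum, (hW _ i).2, mul_one]
  exact hP.2

theorem IsEquilibrium.stationary {π : 𝒴 → ℝ} (h : IsEquilibrium P W π) (j : 𝒴) :
    ∑ i, π i * inducedMatrix P W i j = π j := by
  rw [h.balance j, Finset.sum_comm]
  simp [inducedMatrix, Finset.mul_sum, mul_assoc]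

theorem isEquilibrium_of_stationary {π : 𝒴 → ℝ} (h : π ∈ stdSimplex ℝ 𝒴)
    (hst : ∀ j, ∑ i, π i * inducedMatrix P W i j = π j) : IsEquilibrium P W π := by
  refine ⟨h, fun j => ?_⟩
  rw [← hst j, Finset.sum_comm]
  simp [inducedMatrix, Finset.mul_sum, mul_assoc]

theorem IsGenerated.measureReal_preimage [MeasurableSpace 𝒳] [DiscreteMeasurableSpace 𝒳]
    [MeasurableSpace 𝒴] [DiscreteMeasurableSpace 𝒴] {Ω : Type*} [MeasurableSpace Ω]
    {μ : Measure Ω} [IsProbabilityMeasure μ] {n : ℕ} {X : Fin n → Ω → 𝒳}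
    {Y : Fin (n + 1) → Ω → 𝒴} (h : IsGenerated μ P W X Y)
    (B : Finset ((Fin n → 𝒳) × (Fin (n + 1) → 𝒴))) :
    μ.real {ω | ((fun t => X t ω), (fun t => Y t ω)) ∈ B} =
      ∑ p ∈ B, μ.real {ω | Y 0 ω = p.2 0} * pathWeight P W p.1 p.2 := by
  have hZ : Measurable fun ω => ((fun t => X t ω), (fun t => Y t ω)) :=
    (measurable_pi_lambda _ h.measurable_input).prodMk (measurable_pi_lambda _ h.measurable_output)
  have h1 := map_measureReal_apply (μ := μ) hZ B.measurableSet
  have h2 := sum_measureReal_singleton (μ := μ.map fun ω => ((fun t => X t ω), (fun t => Y t ω))) B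
  refine (h1.symm.trans h2.symm).trans (Finset.sum_congr rfl fun p _ => ?_)
  rw [map_measureReal_apply hZ (measurableSet_singleton p), pathWeight, ← h.law]
  congr 1
  ext ω
  simp [Prod.ext_iff, funext_iff]

theorem initial_mem_stdSimplex [MeasurableSpace 𝒴] [DiscreteMeasurableSpace 𝒴] {Ω : Type*}
    [MeasurableSpace Ω] {μ : Measure Ω} [IsProbabilityMeasure μ] {Z : Ω → 𝒴}
    (hZ : Measurable Z) : (fun i => μ.real {ω | Z ω = i}) ∈ stdSimplex ℝ 𝒴 := by
  refine ⟨fun i => measureReal_nonneg, ?_⟩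
  have := Measure.isProbabilityMeasure_map (μ := μ) hZ.aemeasurable
  have h1 := sum_measureReal_singleton (μ := μ.map Z) Finset.univ
  rw [Finset.coe_univ, probReal_univ] at h1
  rw [← h1]
  exact Finset.sum_congr rfl fun i _ =>
    (map_measureReal_apply hZ (measurableSet_singleton i)).symm

variable [DecidableEq 𝒳] [DecidableEq 𝒴]

/-- In equilibrium the triple has law `target`, so centring removes the exact mean; this supplies
`hF` in `exists_second_moment_bound`. -/
theorem sum_centredIndicator {π : 𝒴 → ℝ} (hπ : ∑ i, π i = 1)
    (hPW : ∀ i, ∑ x, ∑ j, P x * W x i j = 1) (a : 𝒴 × 𝒳 × 𝒴) :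
    ∑ i, π i * ∑ x, ∑ j, P x * W x i j * centredIndicator π P W a i x j = 0 := by
  have h1 : ∑ i, ∑ x, ∑ j, π i * (P x * W x i j) * (if (i, x, j) = a then 1 else 0) =
      target π P W a.1 a.2.1 a.2.2 := by
    have : ∑ b : 𝒴 × 𝒳 × 𝒴, π b.1 * (P b.2.1 * W b.2.1 b.1 b.2.2) * (if b = a then 1 else 0) =
        target π P W a.1 a.2.1 a.2.2 := by
      simp [target, mul_assoc]
    rw [← this]
    simp_rw [Fintype.sum_prod_type]
  simp only [centredIndicator, mul_sub, Finset.sum_sub_distrib]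
  simp_rw [← Finset.sum_mul, hPW, one_mul, ← Finset.sum_mul, hπ, one_mul, Finset.mul_sum,
    ← mul_assoc]
  rw [sub_eq_zero, ← h1]
  simp only [mul_assoc]

/-- Pointwise form of Chebyshev's inequality: Cauchy–Schwarz over the triples turns the `ℓ¹`
deviation into a sum of squares. -/
theorem one_le_of_notMem_typicalSet {π : 𝒴 → ℝ} {n : ℕ} (hn : n ≠ 0) {δ : ℝ} (hδ : 0 < δ)
    {p : (Fin n → 𝒳) × (Fin (n + 1) → 𝒴)} (hp : p ∉ typicalSet n δ (target π P W)) :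
    1 ≤ Fintype.card (𝒴 × 𝒳 × 𝒴) / (n ^ 2 * δ ^ 2) *
      ∑ a, pathSum (centredIndicator π P W a) p.1 p.2 ^ 2 := by
  have hn' : (0 : ℝ) < n := Nat.cast_pos.2 (Nat.pos_of_ne_zero hn)
  have h1 : δ < ∑ a, |pathSum (centredIndicator π P W a) p.1 p.2 / n| := by
    simp_rw [← empirical_sub_target hn, Fintype.sum_prod_type]
    exact not_le.1 hp
  have h2 := sq_sum_le_card_mul_sum_sq (s := Finset.univ)
    (f := fun a => |pathSum (centredIndicator π P W a) p.1 p.2 / n|)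
  simp_rw [sq_abs, div_pow, ← Finset.sum_div] at h2
  have h3 := (pow_le_pow_left₀ hδ.le h1.le 2).trans h2
  rw [Finset.card_univ] at h3
  rw [div_mul_eq_mul_div, one_le_div (by positivity)]
  rw [← mul_div_assoc, le_div_iff₀ (by positivity)] at h3
  linarith

/-- Chebyshev's inequality for the atypical sequences. -/
theorem exists_atypical_bound (hP : P ∈ stdSimplex ℝ 𝒳) (hW : ∀ x i, W x i ∈ stdSimplex ℝ 𝒴)
    {k : 𝒴} (hk : ∀ i, Accessible (inducedMatrix P W) i k) {π : 𝒴 → ℝ}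
    (hπ : IsEquilibrium P W π) {δ : ℝ} (hδ : 0 < δ) :
    ∃ K : ℝ, ∀ (n : ℕ), n ≠ 0 → ∀ ν ∈ stdSimplex ℝ 𝒴,
      ∀ B : Finset ((Fin n → 𝒳) × (Fin (n + 1) → 𝒴)),
        (∀ p ∈ B, p ∉ typicalSet n δ (target π P W)) →
        ∑ p ∈ B, ν (p.2 0) * pathWeight P W p.1 p.2 ≤ K / n := by
  have hPW := sum_weight_mul_eq_one hP hW
  choose K hK using fun a => exists_second_moment_bound hP.1 (fun x i => (hW x i).1) hPW hk
    hπ.mem_simplex.2 hπ.stationary (sum_centredIndicator hπ.mem_simplex.2 hPW a)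
  have hK0 : 0 ≤ ∑ a, K a := Finset.sum_nonneg fun a _ => by
    -- At `n = 0` the path sum is empty, so the moment bound reads `0 ≤ K a`.
    have := hK a 0 π hπ.mem_simplex
    simpa [pathSum] using this
  -- The factor 2 comes from `n + 1 ≤ 2 * n`.
  refine ⟨Fintype.card (𝒴 × 𝒳 × 𝒴) / δ ^ 2 * (2 * ∑ a, K a), fun n hn ν hν B hB => ?_⟩
  have hn' : (1 : ℝ) ≤ n := Nat.one_le_cast.2 (Nat.one_le_iff_ne_zero.2 hn)
  have hw : ∀ p : (Fin n → 𝒳) × (Fin (n + 1) → 𝒴), 0 ≤ ν (p.2 0) * pathWeight P W p.1 p.2 :=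
    fun p => mul_nonneg (hν.1 _) (pathWeight_nonneg hP.1 (fun x i => (hW x i).1) _ _)
  set c : ℝ := Fintype.card (𝒴 × 𝒳 × 𝒴) / (n ^ 2 * δ ^ 2) with hc
  have hc0 : 0 ≤ c := by positivity
  calc ∑ p ∈ B, ν (p.2 0) * pathWeight P W p.1 p.2
      ≤ ∑ p ∈ B, ν (p.2 0) * pathWeight P W p.1 p.2 *
          (c * ∑ a, pathSum (centredIndicator π P W a) p.1 p.2 ^ 2) :=
        Finset.sum_le_sum fun p hp =>
          le_mul_of_one_le_right (hw p) (one_le_of_notMem_typicalSet hn hδ (hB p hp))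
    _ ≤ ∑ p : (Fin n → 𝒳) × (Fin (n + 1) → 𝒴), ν (p.2 0) * pathWeight P W p.1 p.2 *
          (c * ∑ a, pathSum (centredIndicator π P W a) p.1 p.2 ^ 2) :=
        Finset.sum_le_univ_sum_of_nonneg fun p => mul_nonneg (hw p)
          (mul_nonneg hc0 (Finset.sum_nonneg fun a _ => sq_nonneg _))
    _ = c * ∑ a, ∑ xs : Fin n → 𝒳, ∑ ys : Fin (n + 1) → 𝒴,
          ν (ys 0) * pathWeight P W xs ys * pathSum (centredIndicator π P W a) xs ys ^ 2 := by
        simp_rw [Finset.mul_sum]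
        rw [Finset.sum_comm]
        refine Finset.sum_congr rfl fun a _ => ?_
        rw [Fintype.sum_prod_type]
        exact Finset.sum_congr rfl fun xs _ => Finset.sum_congr rfl fun ys _ => by ring
    _ ≤ c * ∑ a, K a * (n + 1) :=
        mul_le_mul_of_nonneg_left (Finset.sum_le_sum fun a _ => hK a n ν hν) hc0
    _ ≤ c * ((∑ a, K a) * (2 * n)) := by
        rw [← Finset.sum_mul]
        gcongr
        linarith
    _ = _ := by
        rw [hc]
        field_simp

end Typicality

end InputDrivenMarkov

/-! ### The main theorem. -/

theorem theorem2 {𝒳 𝒴 : Type*} [Fintype 𝒳] [DecidableEq 𝒳] [Fintype 𝒴] [DecidableEq 𝒴]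
    [MeasurableSpace 𝒳] [DiscreteMeasurableSpace 𝒳]
    [MeasurableSpace 𝒴] [DiscreteMeasurableSpace 𝒴]
    (P : 𝒳 → ℝ) (hP : P ∈ stdSimplex ℝ 𝒳)
    (W : 𝒳 → 𝒴 → 𝒴 → ℝ) (hW : ∀ x i, W x i ∈ stdSimplex ℝ 𝒴)
    (R : Set 𝒴)
    (hR : InputDrivenMarkov.IsUniqueErgodicClass (InputDrivenMarkov.inducedMatrix P W) R) :
    ∃ π : 𝒴 → ℝ,
      InputDrivenMarkov.IsEquilibrium P W π ∧
      (∀ i, i ∉ R → π i = 0) ∧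
      (∀ π' : 𝒴 → ℝ, InputDrivenMarkov.IsEquilibrium P W π' → π' = π) ∧
      ∀ (Ω : ℕ → Type*) [∀ n, MeasurableSpace (Ω n)]
        (ℙ : ∀ n, Measure (Ω n)) [∀ n, IsProbabilityMeasure (ℙ n)]
        (X : ∀ n, Fin n → Ω n → 𝒳) (Y : ∀ n, Fin (n + 1) → Ω n → 𝒴),
        (∀ n, InputDrivenMarkov.IsGenerated (ℙ n) P W (X n) (Y n)) →
        ∀ δ : ℝ, 0 < δ →
          Tendsto
            (fun n : ℕ => ℙ n {ω | ((fun t => X n t ω), (fun t => Y n t ω)) ∈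
              InputDrivenMarkov.typicalSet n δ (InputDrivenMarkov.target π P W)})
            atTop (𝓝 1) := by
  have hT : ∀ i j, 0 ≤ InputDrivenMarkov.inducedMatrix P W i j := fun i j =>
    Finset.sum_nonneg fun x _ => mul_nonneg (hP.1 x) ((hW x i).1 j)
  have hs : ∀ i, ∑ j, InputDrivenMarkov.inducedMatrix P W i j = 1 := fun i => by
    rw [← InputDrivenMarkov.sum_weight_mul_eq_one hP hW i, Finset.sum_comm]
    rfl
  obtain ⟨hclosed, k, hkR, hk⟩ := hR.closed_and_reachable hT hs
  have : Nonempty 𝒴 := ⟨k⟩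
  obtain ⟨π, hπ, hst⟩ := InputDrivenMarkov.exists_stationary hT hs
  have heq := InputDrivenMarkov.isEquilibrium_of_stationary hπ hst
  refine ⟨π, heq, fun i hi => InputDrivenMarkov.stationary_eq_zero_of_notMem hT hs hclosed hkR hk
    hπ.1 hst hi, fun π' h' => InputDrivenMarkov.stationary_unique hT hs hk hπ.2 hst
    h'.mem_simplex.2 h'.stationary, ?_⟩
  intro Ω _ ℙ _ X Y hgen δ hδ
  classical
  obtain ⟨K, hK⟩ := InputDrivenMarkov.exists_atypical_bound hP hW hk heq hδ
  set A : ∀ n, Set (Ω n) := fun n => {ω | ((fun t => X n t ω), (fun t => Y n t ω)) ∈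
    InputDrivenMarkov.typicalSet n δ (InputDrivenMarkov.target π P W)} with hA
  have hmeas : ∀ n, MeasurableSet (A n) := fun n =>
    ((measurable_pi_lambda _ (hgen n).measurable_input).prodMk
      (measurable_pi_lambda _ (hgen n).measurable_output)) (Set.toFinite _).measurableSet
  -- `K` does not depend on the initial law, so the law of `Y n 0` may vary with `n`.
  have hlow : ∀ n, n ≠ 0 → 1 - K / n ≤ (ℙ n).real (A n) := by
    intro n hn
    have h1 := (hgen n).measureReal_preimage (Finset.univ.filter fun p =>
      p ∉ InputDrivenMarkov.typicalSet n δ (InputDrivenMarkov.target π P W))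
    have h2 := hK n hn _ (InputDrivenMarkov.initial_mem_stdSimplex (μ := ℙ n)
      ((hgen n).measurable_output 0)) (Finset.univ.filter fun p =>
        p ∉ InputDrivenMarkov.typicalSet n δ (InputDrivenMarkov.target π P W))
      fun p hp => (Finset.mem_filter.1 hp).2
    have h3 := h1.trans_le h2
    simp only [Finset.mem_filter, Finset.mem_univ, true_and] at h3
    have h4 : (ℙ n).real (A n)ᶜ ≤ K / n := h3
    rw [probReal_compl_eq_one_sub (hmeas n)] at h4
    linarith
  have hreal : Tendsto (fun n => (ℙ n).real (A n)) atTop (𝓝 1) := by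
    refine tendsto_of_tendsto_of_tendsto_of_le_of_le' (g := fun n : ℕ => 1 - K / n) ?_
      tendsto_const_nhds ?_ (Eventually.of_forall fun n => measureReal_le_one)
    · simpa using tendsto_const_nhds.sub (tendsto_const_div_atTop_nhds_zero_nat K)
    · filter_upwards [eventually_ne_atTop 0] with n hn using hlow n hn
  rw [← ENNReal.ofReal_one]
  exact (ENNReal.tendsto_ofReal hreal).congr fun n => ofReal_measureReal
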